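/- Let $S=k[x_1,\ldots,x_n]$ be a polynomial ring over a field $k$, and let $M=(m_1,\ldots,m_q)\subseteq S$ be the ideal generated by monomials $m_i=x_1^{\alpha_{i1}}\cdots x_n^{\alpha_{in}}$, $1\le i\le q$ (for example, the minimal monomial generators of a monomial ideal $M$). Let $m=\mathrm{lcm}(m_1,\ldots,m_q)=x_1^{\alpha_1}\cdots x_n^{\alpha_n}$, where $\alpha_j=\max(\alpha_{1j},\ldots,\alpha_{qj})$ (and $m=1$ if $q=0$). Let $M'=(m'_1,\ldots,m'_q)$ be the twin ideal of $M$, where $m'_i=x_1^{\beta_{i1}}\cdots x_n^{\beta_{in}}$ with $\beta_{ij}=\alpha_j$ if $\alpha_{ij}=\alpha_j$, and $\beta_{ij}=0$ otherwise. For a monomial ideal $I\subseteq S$, a monomial $l$ and $i\ge 0$, the multigraded Betti number $\beta_{i,l}(S/I)$ is the number of basis elements of multidegree $l$ in homological degree $i$ of a minimal multigraded free resolution of $S/I$, that is, an $\mathbb{N}^n$-graded resolution $\cdots\to F_1\to F_0\to S/I\to 0$ by finitely generated free $S$-modules with homogeneous bases such that no matrix of a differential $F_{i+1}\to F_i$,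 $i\ge 0$, has an invertible entry; such a resolution exists, and this number does not depend on its choice. Then, for all $i\ge 0$, $$\beta_{i,m}(S/M)=\beta_{i,m}(S/M').$$ -/

import Mathlib

/-- Monomials of `S = k[x_1, …, x_n]` are given by their exponent vectors `Fin n →₀ ℕ`.
`monomialIdeal k a` is the ideal of `S` generated by the monomials with exponent vectors
`a 0, …, a (q - 1)`. -/
noncomputable def monomialIdeal (k : Type*) [Field k] {n q : ℕ} (a : Fin q → Fin n →₀ ℕ) :
    Ideal (MvPolynomial (Fin n) k) :=
  Ideal.span (Set.range fun j => MvPolynomial.monomial (a j) (1 : k))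

/-- The exponent vector of the least common multiple of the given monomials: the componentwise
maximum of the exponent vectors (the zero vector, i.e. the monomial `1`, if `q = 0`). -/
noncomputable def lcmExponent {n q : ℕ} (a : Fin q → Fin n →₀ ℕ) : Fin n →₀ ℕ :=
  Finset.univ.sup a

/-- The exponent vectors of the twin monomials: the exponent of `x_v` in the `j`-th monomial is
kept if it equals the exponent of `x_v` in the least common multiple of all the given monomials,
and is replaced by `0` otherwise. -/
noncomputable def twinExponent {n q : ℕ} (a : Fin q → Fin n →₀ ℕ) (j : Fin q) : Fin n →₀ ℕ :=
  Finsupp.equivFunOnFinite.symm fun v =>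
    if a j v = lcmExponent a v then lcmExponent a v else 0

/-- A multigraded (that is, `ℕ^n`-graded) free resolution
`⋯ → F_2 → F_1 → F_0 → S/I → 0` of `S/I` by free modules of finite rank. `F_i` is the free
`S`-module on the finite set `basis i` and the basis element `b` has multidegree `mdeg i b`. The
map `d i : F_{i+1} → F_i` and the augmentation `aug : F_0 → S/I` are homogeneous of multidegree
zero. -/
structure MultigradedFreeResolution {k : Type*} [Field k] {n : ℕ}
    (I : Ideal (MvPolynomial (Fin n) k)) where
  basis : ℕ → Type
  finite_basis : ∀ i, Finite (basis i)
  mdeg : ∀ i, basis i → Fin n →₀ ℕ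
  d : ∀ i, (basis (i + 1) →₀ MvPolynomial (Fin n) k) →ₗ[MvPolynomial (Fin n) k]
    (basis i →₀ MvPolynomial (Fin n) k)
  aug : (basis 0 →₀ MvPolynomial (Fin n) k) →ₗ[MvPolynomial (Fin n) k]
    (MvPolynomial (Fin n) k ⧸ I)
  /-- Every term `c x^e` of the entry of the matrix of `d i` at `(b', b)` satisfies
  `x^e · mdeg b' = mdeg b`. -/
  d_homogeneous : ∀ i (b : basis (i + 1)) (b' : basis i),
    ∀ e ∈ (d i (Finsupp.single b 1) b').support, e + mdeg i b' = mdeg (i + 1) b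
  /-- The augmentation sends `b` to the class of a scalar multiple of the monomial `mdeg b`. -/
  aug_homogeneous : ∀ b : basis 0, ∃ c : k,
    aug (Finsupp.single b 1) = Ideal.Quotient.mk I (MvPolynomial.monomial (mdeg 0 b) c)
  exact_d : ∀ i, Function.Exact (d (i + 1)) (d i)
  exact_aug : Function.Exact (d 0) aug
  aug_surjective : Function.Surjective aug

namespace MultigradedFreeResolution

variable {k : Type*} [Field k] {n : ℕ} {I : Ideal (MvPolynomial (Fin n) k)}

/-- The resolution is minimal if no entry of a differential matrix is invertible. -/
def IsMinimal (F : MultigradedFreeResolution I) : Prop :=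
  ∀ i (b : F.basis (i + 1)) (b' : F.basis i), ¬ IsUnit (F.d i (Finsupp.single b 1) b')

/-- The number of basis elements of `F_i` of multidegree `l`. -/
noncomputable def numBasis (F : MultigradedFreeResolution I) (i : ℕ) (l : Fin n →₀ ℕ) : ℕ :=
  Nat.card {b : F.basis i // F.mdeg i b = l}

end MultigradedFreeResolution

/-- `β` is the multigraded Betti number of `S/I` in homological degree `i` and multidegree `l`:
`S/I` has a minimal multigraded free resolution, and in each such resolution exactly `β` basis
elements in homological degree `i` have multidegree `l`. In particular `β` is uniquely
determined by `I`, `i` and `l`. -/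
def IsMultigradedBetti {k : Type*} [Field k] {n : ℕ} (I : Ideal (MvPolynomial (Fin n) k))
    (i : ℕ) (l : Fin n →₀ ℕ) (β : ℕ) : Prop :=
  (∃ F : MultigradedFreeResolution I, F.IsMinimal) ∧
    ∀ F : MultigradedFreeResolution I, F.IsMinimal → F.numBasis i l = β

open Finsupp in
/-- An augmented complex of based `k`-vector spaces, filtered by the degrees of the basis elements
in `P` and exact in each degree `p`. The homology of the degree `p` part is `k` if `p ∈ U` and zero
otherwise. -/
structure FilteredResolution (k : Type*) [Field k] {P : Type*} [PartialOrder P] (U : Set P) where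
  cell : ℕ → Type
  finite_cell : ∀ i, Finite (cell i)
  deg : ∀ i, cell i → P
  d : ∀ i, (cell (i + 1) →₀ k) →ₗ[k] (cell i →₀ k)
  aug : (cell 0 →₀ k) →ₗ[k] k
  d_mem : ∀ i b, d i (single b 1) ∈ supported k k {b' | deg i b' ≤ deg (i + 1) b}
  d_d : ∀ i x, d i (d (i + 1) x) = 0
  exact_d : ∀ i p, ∀ z ∈ supported k k {b | deg (i + 1) b ≤ p}, d i z = 0 →
    ∃ y ∈ supported k k {b | deg (i + 2) b ≤ p}, d (i + 1) y = z
  aug_d : ∀ p ∈ U, ∀ y ∈ supported k k {b | deg 1 b ≤ p}, aug (d 0 y) = 0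
  exact_aug : ∀ p, ∀ z ∈ supported k k {b | deg 0 b ≤ p}, (p ∈ U → aug z = 0) →
    ∃ y ∈ supported k k {b | deg 1 b ≤ p}, d 0 y = z
  aug_surjective : ∀ p ∈ U, ∃ z ∈ supported k k {b | deg 0 b ≤ p}, aug z = 1

/-! ### Comparison of filtered complexes -/

namespace FilteredResolution

open Finsupp

variable {k : Type*} [Field k] {P : Type*} [PartialOrder P] {U : Set P}

/-- The part of degree at most `p` of the `i`-th space. -/
noncomputable def level (X : FilteredResolution k U) (i : ℕ) (p : P) : Submodule k (X.cell i →₀ k) :=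
  supported k k {b | X.deg i b ≤ p}

/-- The boundaries of degree at most `p`. -/
noncomputable def bdry (X : FilteredResolution k U) (i : ℕ) (p : P) : Submodule k (X.cell i →₀ k) :=
  (X.level (i + 1) p).map (X.d i)

lemma level_mono (X : FilteredResolution k U) (i : ℕ) : Monotone (X.level i) :=
  fun _ _ h => supported_mono fun _ hb => le_trans hb h

lemma single_mem_level (X : FilteredResolution k U) (i : ℕ) (b : X.cell i) (c : k) :
    single b c ∈ X.level i (X.deg i b) :=
  single_mem_supported k c le_rfl

lemma map_mem_of_single {X : FilteredResolution k U} {i : ℕ} {N : Type*} [AddCommGroup N]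
    [Module k N] (f : (X.cell i →₀ k) →ₗ[k] N) {L : P → Submodule k N} (hL : Monotone L)
    (hf : ∀ b, f (single b 1) ∈ L (X.deg i b)) {p : P} {x : X.cell i →₀ k}
    (hx : x ∈ X.level i p) : f x ∈ L p := by
  have : X.level i p ≤ (L p).comap f := by
    rw [level, supported_eq_span_single, Submodule.span_le]
    rintro _ ⟨b, hb, rfl⟩
    exact hL hb (hf b)
  exact this hx

lemma d_mem_level (X : FilteredResolution k U) (i : ℕ) {p : P} {x : X.cell (i + 1) →₀ k}
    (hx : x ∈ X.level (i + 1) p) : X.d i x ∈ X.level i p :=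
  map_mem_of_single (X.d i) (X.level_mono i) (X.d_mem i) hx

lemma mem_bdry_succ (X : FilteredResolution k U) {i : ℕ} {p : P} {z : X.cell (i + 1) →₀ k}
    (hz : z ∈ X.level (i + 1) p) (h : X.d i z = 0) : z ∈ X.bdry (i + 1) p :=
  X.exact_d i p z hz h

lemma mem_bdry_zero (X : FilteredResolution k U) {p : P} {z : X.cell 0 →₀ k}
    (hz : z ∈ X.level 0 p) (h : p ∈ U → X.aug z = 0) : z ∈ X.bdry 0 p :=
  X.exact_aug p z hz h

/-- A linear map whose values on basis elements are boundaries lifts through the differential. -/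
lemma exists_lift {X Y : FilteredResolution k U} {i j : ℕ}
    (g : (X.cell j →₀ k) →ₗ[k] (Y.cell i →₀ k))
    (hg : ∀ b, g (single b 1) ∈ Y.bdry i (X.deg j b)) :
    ∃ h : (X.cell j →₀ k) →ₗ[k] (Y.cell (i + 1) →₀ k),
      (∀ b, h (single b 1) ∈ Y.level (i + 1) (X.deg j b)) ∧ ∀ x, Y.d i (h x) = g x := by
  choose w hw hdw using hg
  refine ⟨linearCombination k w, fun b => by simpa using hw b, fun x => ?_⟩
  have : (Y.d i).comp (linearCombination k w) = g := by
    ext1 b; ext1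
    simpa using hdw b
  exact LinearMap.congr_fun this x

/-- A filtered map which sends boundaries to boundaries. -/
def IsPartialChainMap {X Y : FilteredResolution k U} {i : ℕ}
    (f : (X.cell i →₀ k) →ₗ[k] (Y.cell i →₀ k)) : Prop :=
  (∀ b, f (single b 1) ∈ Y.level i (X.deg i b)) ∧
    ∀ p, ∀ x ∈ X.level (i + 1) p, f (X.d i x) ∈ Y.bdry i p

/-- Start of the comparison map. Since `U` is a lower set, every basis element below some `p ∈ U`
has degree in `U`, so prescribing augmentations on those basis elements controls them on the whole
level. -/
lemma exists_isPartialChainMap_zero (hU : IsLowerSet U) (X Y : FilteredResolution k U) :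
    ∃ f : (X.cell 0 →₀ k) →ₗ[k] (Y.cell 0 →₀ k), IsPartialChainMap f ∧
      ∀ p ∈ U, ∀ x ∈ X.level 0 p, Y.aug (f x) = X.aug x := by
  classical
  have key : ∀ b : X.cell 0, ∃ w ∈ Y.level 0 (X.deg 0 b),
      X.deg 0 b ∈ U → Y.aug w = X.aug (single b 1) := by
    intro b
    by_cases hb : X.deg 0 b ∈ U
    · obtain ⟨z, hz, h1⟩ := Y.aug_surjective _ hb
      exact ⟨X.aug (single b 1) • z, Submodule.smul_mem _ _ hz, fun _ => by simp [h1]⟩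
    -- Outside `U` the target has no homology, so any value works.
    · exact ⟨0, Submodule.zero_mem _, fun h => absurd h hb⟩
  choose w hw haug using key
  have hf : ∀ b, linearCombination k w (single b 1) ∈ Y.level 0 (X.deg 0 b) := fun b => by
    simpa using hw b
  have ha : ∀ p ∈ U, ∀ x ∈ X.level 0 p, Y.aug (linearCombination k w x) = X.aug x := by
    intro p hp x hx
    have : X.level 0 p ≤ LinearMap.ker ((Y.aug).comp (linearCombination k w) - X.aug) := by
      rw [level, supported_eq_span_single, Submodule.span_le]
      rintro _ ⟨b, hb, rfl⟩
      simp [haug b (hU hb hp)]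
    simpa [sub_eq_zero] using this hx
  refine ⟨linearCombination k w, ⟨hf, fun p x hx => ?_⟩, ha⟩
  refine Y.mem_bdry_zero (map_mem_of_single _ (Y.level_mono 0) hf (X.d_mem_level 0 hx)) fun hp => ?_
  rw [ha p hp _ (X.d_mem_level 0 hx), X.aug_d p hp x hx]

lemma IsPartialChainMap.exists_succ {X Y : FilteredResolution k U} {i : ℕ}
    {f : (X.cell i →₀ k) →ₗ[k] (Y.cell i →₀ k)} (hf : IsPartialChainMap f) :
    ∃ g : (X.cell (i + 1) →₀ k) →ₗ[k] (Y.cell (i + 1) →₀ k), IsPartialChainMap g ∧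
      ∀ x, Y.d i (g x) = f (X.d i x) := by
  obtain ⟨g, hg, hd⟩ := exists_lift (f.comp (X.d i))
    fun b => hf.2 _ _ (X.single_mem_level (i + 1) b 1)
  refine ⟨g, ⟨hg, fun p x hx => Y.mem_bdry_succ ?_ ?_⟩, hd⟩
  · exact map_mem_of_single _ (Y.level_mono _) hg (X.d_mem_level _ hx)
  · simp [hd, X.d_d]

lemma IsPartialChainMap.mem_level {X Y : FilteredResolution k U} {i : ℕ}
    {f : (X.cell i →₀ k) →ₗ[k] (Y.cell i →₀ k)} (hf : IsPartialChainMap f) {p : P}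
    {x : X.cell i →₀ k} (hx : x ∈ X.level i p) : f x ∈ Y.level i p :=
  map_mem_of_single _ (Y.level_mono _) hf.1 hx

/-- The differentials have no coefficients at basis elements of degree `t`. -/
def IsMinimalAt (X : FilteredResolution k U) (t : P) : Prop :=
  ∀ i x b, X.deg i b = t → X.d i x b = 0

/-- A filtered map cannot raise degrees, so a maximal degree in the output can only come from the
same degree in the input. -/
lemma apply_eq_zero_of_filtered {X Y : FilteredResolution k U} {t : P} (ht : IsMax t) {i j : ℕ}
    (f : (X.cell i →₀ k) →ₗ[k] (Y.cell j →₀ k))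
    (hf : ∀ b, f (single b 1) ∈ Y.level j (X.deg i b)) {x : X.cell i →₀ k}
    (hx : ∀ b, X.deg i b = t → x b = 0) {c : Y.cell j} (hc : Y.deg j c = t) : f x c = 0 := by
  have hx' : x ∈ supported k k {b | X.deg i b ≠ t} := by
    rw [mem_supported']
    intro b hb
    exact hx b (by simpa using hb)
  have : supported k k {b | X.deg i b ≠ t} ≤ LinearMap.ker ((lapply c).comp f) := by
    rw [supported_eq_span_single, Submodule.span_le]
    rintro _ ⟨b, hb, rfl⟩
    have h := hf b
    rw [level, mem_supported'] at h
    refine h c fun hcb => hb ?_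
    have hcb : Y.deg j c ≤ X.deg i b := hcb
    rw [hc] at hcb
    exact (ht.eq_of_le hcb).symm
  simpa using this hx'

/-- Comparison maps in both directions, whose composition is the identity up to coefficients at
basis elements of degree less than `t`. -/
lemma exists_comparison (hU : IsLowerSet U) {t : P} (ht : IsMax t) (X Y : FilteredResolution k U)
    (hX : X.IsMinimalAt t) (i : ℕ) :
    ∃ (f : (X.cell i →₀ k) →ₗ[k] (Y.cell i →₀ k)) (g : (Y.cell i →₀ k) →ₗ[k] (X.cell i →₀ k))
      (r : (X.cell i →₀ k) →ₗ[k] (X.cell i →₀ k)),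
      IsPartialChainMap f ∧ IsPartialChainMap g ∧ (∀ b, r (single b 1) ∈ X.bdry i (X.deg i b)) ∧
      (∀ x, r (X.d i x) = g (f (X.d i x)) - X.d i x) ∧
      ∀ x b, X.deg i b = t → g (f x) b - x b - r x b = 0 := by
  induction i with
  | zero =>
    obtain ⟨f, hf, hfa⟩ := exists_isPartialChainMap_zero hU X Y
    obtain ⟨g, hg, hga⟩ := exists_isPartialChainMap_zero hU Y X
    refine ⟨f, g, g.comp f - LinearMap.id, hf, hg, fun b => ?_, fun x => rfl, fun x b _ => ?_⟩
    · have hb := X.single_mem_level 0 b 1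
      refine X.mem_bdry_zero (Submodule.sub_mem _ (hg.mem_level (hf.mem_level hb)) hb) fun hp => ?_
      simp only [LinearMap.sub_apply, LinearMap.comp_apply, LinearMap.id_apply, map_sub]
      rw [hga _ hp _ (hf.mem_level hb), hfa _ hp _ hb, sub_self]
    · simp
  | succ i ih =>
    obtain ⟨f, g, r, hf, hg, hr, hrd, -⟩ := ih
    obtain ⟨f', hf', hfd⟩ := hf.exists_succ
    obtain ⟨g', hg', hgd⟩ := hg.exists_succ
    -- The next piece of the homotopy: `d h = r`, which makes the values of the new `r` cycles,
    -- hence boundaries.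
    obtain ⟨h, hh, hdh⟩ := exists_lift r hr
    refine ⟨f', g', g'.comp f' - LinearMap.id - h.comp (X.d i), hf', hg', fun b => ?_,
      fun x => ?_, fun x b hb => ?_⟩
    · have hb := X.single_mem_level (i + 1) b 1
      refine X.mem_bdry_succ (Submodule.sub_mem _
        (Submodule.sub_mem _ (hg'.mem_level (hf'.mem_level hb)) hb)
        (map_mem_of_single _ (X.level_mono _) hh (X.d_mem_level i hb))) ?_
      simp [hgd, hfd, hdh, hrd]
    · simp [X.d_d]
    -- The discrepancy is `h (d x)`: by minimality `d x` has no coefficients in degree `t`, and `h`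
    -- cannot create any.
    · have := apply_eq_zero_of_filtered ht h hh (x := X.d i x) (fun b hb => hX i x b hb) hb
      simp [this]

/-- On coefficients of degree `t` the composite `gf` is the identity, so `f` is injective there.
Only `X` has to be minimal. -/
lemma card_le_of_isMinimalAt (hU : IsLowerSet U) {t : P} (ht : IsMax t)
    (X Y : FilteredResolution k U) (hX : X.IsMinimalAt t) (i : ℕ) :
    Nat.card {b : X.cell i // X.deg i b = t} ≤ Nat.card {b : Y.cell i // Y.deg i b = t} := by
  classical
  obtain ⟨f, g, r, hf, hg, hr, -, htop⟩ := exists_comparison hU ht X Y hX i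
  have := X.finite_cell i
  have := Y.finite_cell i
  have := Fintype.ofFinite {b : X.cell i // X.deg i b = t}
  have := Fintype.ofFinite {b : Y.cell i // Y.deg i b = t}
  let ι : ({b : X.cell i // X.deg i b = t} →₀ k) →ₗ[k] (X.cell i →₀ k) :=
    lmapDomain k k Subtype.val
  let π : (Y.cell i →₀ k) →ₗ[k] ({b : Y.cell i // Y.deg i b = t} →₀ k) :=
    lsubtypeDomain {b | Y.deg i b = t}
  have hinj : Function.Injective (π.comp (f.comp ι)) := by
    rw [← LinearMap.ker_eq_bot, LinearMap.ker_eq_bot']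
    intro x hx
    have hfx : ∀ b, Y.deg i b = t → f (ι x) b = 0 := fun b hb =>
      DFunLike.congr_fun hx (⟨b, hb⟩ : {b // Y.deg i b = t})
    ext b
    have h1 := apply_eq_zero_of_filtered ht g hg.1 hfx b.2
    have h2 : r (ι x) b = 0 := by
      have : r (ι x) ∈ LinearMap.range (X.d i) := by
        -- The constant family of submodules turns this into the statement that `r` maps into the
        -- image of the differential, which minimality makes invisible in degree `t`.
        have := map_mem_of_single (p := t) (x := ι x) r
          (L := fun _ => LinearMap.range (X.d i)) (fun _ _ _ => le_rfl)
          (fun b => by obtain ⟨y, -, hy⟩ := hr b; exact ⟨y, hy⟩)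
        refine this ?_
        rw [level, mem_supported']
        intro c hc
        refine mapDomain_of_notMem_range _ _ ?_
        rintro ⟨c', rfl⟩
        exact hc c'.2.le
      obtain ⟨y, hy⟩ := this
      rw [← hy]
      exact hX i y b b.2
    have h3 := htop (ι x) b b.2
    rw [h1, h2, zero_sub, sub_zero, neg_eq_zero] at h3
    exact (mapDomain_apply Subtype.val_injective x b).symm.trans h3
  have := LinearMap.finrank_le_finrank_of_injective hinj
  simpa [Nat.card_eq_fintype_card] using this

theorem card_eq_of_isMinimalAt (hU : IsLowerSet U) {t : P} (ht : IsMax t)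
    (X Y : FilteredResolution k U) (hX : X.IsMinimalAt t) (hY : Y.IsMinimalAt t) (i : ℕ) :
    Nat.card {b : X.cell i // X.deg i b = t} = Nat.card {b : Y.cell i // Y.deg i b = t} :=
  le_antisymm (card_le_of_isMinimalAt hU ht X Y hX i) (card_le_of_isMinimalAt hU ht Y X hY i)

end FilteredResolution

/-! ### Homogeneous elements and minimal generators -/

namespace MultigradedFree

open MvPolynomial

variable {k : Type*} [Field k] {n : ℕ} {B B' : Type*}

/-- An element of the free module on `B`, where `b : B` has multidegree `deg b`, is homogeneous of
multidegree `p`. -/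
def IsHomog (deg : B → Fin n →₀ ℕ) (p : Fin n →₀ ℕ) (f : B →₀ MvPolynomial (Fin n) k) : Prop :=
  ∀ b, ∀ e ∈ (f b).support, e + deg b = p

open Classical in
/-- The homogeneous component of multidegree `p`. -/
noncomputable def component (deg : B → Fin n →₀ ℕ) (p : Fin n →₀ ℕ) :
    (B →₀ MvPolynomial (Fin n) k) →+ (B →₀ MvPolynomial (Fin n) k) where
  toFun f := Finsupp.onFinset f.support
    (fun b => if deg b ≤ p then monomial (p - deg b) (coeff (p - deg b) (f b)) else 0) <| by
      intro b hb
      rw [Finsupp.mem_support_iff]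
      rintro h
      simp [h] at hb
  map_zero' := by ext; simp
  map_add' f g := by
    ext b : 1
    by_cases h : deg b ≤ p <;> simp [h]

open Classical in
lemma coeff_component (deg : B → Fin n →₀ ℕ) (p : Fin n →₀ ℕ) (f : B →₀ MvPolynomial (Fin n) k)
    (b : B) (e : Fin n →₀ ℕ) :
    coeff e (component deg p f b) = if e + deg b = p then coeff e (f b) else 0 := by
  simp only [component, AddMonoidHom.coe_mk, ZeroHom.coe_mk, Finsupp.onFinset_apply]
  split_ifs with h1 h2 h2
  · subst h2; simp
  · rw [coeff_monomial, if_neg]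
    rintro rfl
    exact h2 (tsub_add_cancel_of_le h1)
  · exact absurd (h2 ▸ le_add_self) h1
  · simp

lemma isHomog_component (deg : B → Fin n →₀ ℕ) (p : Fin n →₀ ℕ)
    (f : B →₀ MvPolynomial (Fin n) k) : IsHomog deg p (component deg p f) := by
  classical
  intro b e he
  rw [mem_support_iff, coeff_component] at he
  by_contra h
  simp [h] at he

lemma IsHomog.component_eq {deg : B → Fin n →₀ ℕ} {p : Fin n →₀ ℕ}
    {f : B →₀ MvPolynomial (Fin n) k} (hf : IsHomog deg p f) : component deg p f = f := by
  classical
  ext b e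
  rw [coeff_component, ite_eq_left_iff]
  intro h
  by_contra h'
  exact h (hf b e (mem_support_iff.2 (Ne.symm h')))

lemma IsHomog.component_eq_zero {deg : B → Fin n →₀ ℕ} {p q : Fin n →₀ ℕ} (hpq : q ≠ p)
    {f : B →₀ MvPolynomial (Fin n) k} (hf : IsHomog deg q f) : component deg p f = 0 := by
  classical
  ext b e
  rw [coeff_component, Finsupp.zero_apply, coeff_zero, ite_eq_right_iff]
  rintro rfl
  by_contra h'
  exact hpq (hf b e (mem_support_iff.2 h')).symm

lemma IsHomog.monomial_smul {deg : B → Fin n →₀ ℕ} {q : Fin n →₀ ℕ}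
    {f : B →₀ MvPolynomial (Fin n) k} (hf : IsHomog deg q f) (e : Fin n →₀ ℕ) (c : k) :
    IsHomog deg (e + q) (monomial e c • f) := by
  classical
  intro b u hu
  rw [mem_support_iff, Finsupp.smul_apply, smul_eq_mul, coeff_monomial_mul'] at hu
  split_ifs at hu with h
  · rw [← hf b (u - e) (mem_support_iff.2 (right_ne_zero_of_mul hu)), ← add_assoc,
      add_tsub_cancel_of_le h]
  · exact absurd rfl hu

lemma isHomog_single_one (deg : B → Fin n →₀ ℕ) (b : B) :
    IsHomog deg (deg b) (Finsupp.single b (1 : MvPolynomial (Fin n) k)) := by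
  classical
  intro b' e he
  rw [Finsupp.single_apply] at he
  split_ifs at he with h
  · subst h
    rw [mem_support_iff, coeff_one] at he
    simp only [ne_eq, ite_eq_right_iff, one_ne_zero, imp_false, not_not] at he
    simp [← he]
  · simp at he

lemma exists_sum_component (deg : B → Fin n →₀ ℕ) (f : B →₀ MvPolynomial (Fin n) k) :
    ∃ s : Finset (Fin n →₀ ℕ), f = ∑ p ∈ s, component deg p f := by
  classical
  refine ⟨f.support.biUnion fun b => (f b).support.image (· + deg b), ?_⟩
  ext b e
  rw [Finsupp.finsetSum_apply, coeff_sum]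
  simp only [coeff_component, Finset.sum_ite_eq]
  split_ifs with h
  · rfl
  · by_contra h'
    refine h (Finset.mem_biUnion.2 ⟨b, ?_, Finset.mem_image.2 ⟨e, mem_support_iff.2 h', rfl⟩⟩)
    rw [Finsupp.mem_support_iff]
    intro h0
    simp [h0] at h'

/-- Homogeneous maps of multidegree zero commute with taking components. -/
lemma component_map {deg : B → Fin n →₀ ℕ} {deg' : B' → Fin n →₀ ℕ}
    (d : (B' →₀ MvPolynomial (Fin n) k) →ₗ[MvPolynomial (Fin n) k] (B →₀ MvPolynomial (Fin n) k))
    (hd : ∀ b, IsHomog deg (deg' b) (d (Finsupp.single b 1))) (p : Fin n →₀ ℕ)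
    (f : B' →₀ MvPolynomial (Fin n) k) :
    component deg p (d f) = d (component deg' p f) := by
  induction f using Finsupp.induction_linear with
  | zero => simp
  | add f g hf hg => simp only [map_add, hf, hg]
  | single b a =>
    induction a using MvPolynomial.induction_on' with
    | add f g hf hg => simp only [Finsupp.single_add, map_add, hf, hg]
    | monomial e c =>
      have h : Finsupp.single b (monomial e c) =
          monomial e c • Finsupp.single b (1 : MvPolynomial (Fin n) k) := by simp
      have h1 := (isHomog_single_one (k := k) deg' b).monomial_smul e c
      have h2 := (hd b).monomial_smul e c
      rw [h, map_smul]
      by_cases hp : e + deg' b = p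
      · subst hp
        rw [h1.component_eq, h2.component_eq, map_smul]
      · rw [h1.component_eq_zero hp, h2.component_eq_zero hp, map_zero]

lemma IsHomog.map {deg : B → Fin n →₀ ℕ} {deg' : B' → Fin n →₀ ℕ}
    {d : (B' →₀ MvPolynomial (Fin n) k) →ₗ[MvPolynomial (Fin n) k] (B →₀ MvPolynomial (Fin n) k)}
    (hd : ∀ b, IsHomog deg (deg' b) (d (Finsupp.single b 1))) {p : Fin n →₀ ℕ}
    {f : B' →₀ MvPolynomial (Fin n) k} (hf : IsHomog deg' p f) : IsHomog deg p (d f) := by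
  rw [← hf.component_eq, ← component_map d hd]
  exact isHomog_component _ _ _

/-- A submodule which contains the components of its elements. -/
def IsHomogSubmodule (deg : B → Fin n →₀ ℕ)
    (K : Submodule (MvPolynomial (Fin n) k) (B →₀ MvPolynomial (Fin n) k)) : Prop :=
  ∀ f ∈ K, ∀ p, component deg p f ∈ K

lemma isHomogSubmodule_ker {deg : B → Fin n →₀ ℕ} {deg' : B' → Fin n →₀ ℕ}
    {d : (B' →₀ MvPolynomial (Fin n) k) →ₗ[MvPolynomial (Fin n) k] (B →₀ MvPolynomial (Fin n) k)}
    (hd : ∀ b, IsHomog deg (deg' b) (d (Finsupp.single b 1))) :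
    IsHomogSubmodule deg' (LinearMap.ker d) := by
  intro f hf p
  rw [LinearMap.mem_ker] at hf ⊢
  rw [← component_map d hd, hf, map_zero]

lemma IsHomogSubmodule.exists_generators [Finite B] {deg : B → Fin n →₀ ℕ}
    {K : Submodule (MvPolynomial (Fin n) k) (B →₀ MvPolynomial (Fin n) k)}
    (hK : IsHomogSubmodule deg K) :
    ∃ (r : ℕ) (g : Fin r → B →₀ MvPolynomial (Fin n) k) (q : Fin r → Fin n →₀ ℕ),
      (∀ j, IsHomog deg (q j) (g j)) ∧
        Submodule.span (MvPolynomial (Fin n) k) (Set.range g) = K := by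
  classical
  have hspan : Submodule.span (MvPolynomial (Fin n) k) {f | f ∈ K ∧ ∃ q, IsHomog deg q f} = K := by
    refine le_antisymm (Submodule.span_le.2 fun f hf => hf.1) fun f hf => ?_
    obtain ⟨s, hs⟩ := exists_sum_component deg f
    rw [hs]
    exact Submodule.sum_mem _ fun p _ => Submodule.subset_span
      ⟨hK f hf p, p, isHomog_component deg p f⟩
  have hfg : (Submodule.span (MvPolynomial (Fin n) k)
      {f | f ∈ K ∧ ∃ q, IsHomog deg q f}).FG := IsNoetherian.noetherian _
  obtain ⟨t, ht, hst⟩ := (Submodule.fg_span_iff_fg_span_finset_subset _).1 hfg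
  have hq : ∀ j : Fin t.card, ∃ q, IsHomog (k := k) deg q (t.equivFin.symm j) :=
    fun j => (ht (t.equivFin.symm j).2).2
  choose q hq using hq
  refine ⟨t.card, fun j => t.equivFin.symm j, q, hq, ?_⟩
  rw [← hspan, hst]
  congr 1
  ext f
  constructor
  · rintro ⟨j, rfl⟩
    exact (t.equivFin.symm j).2
  · intro hf
    exact ⟨t.equivFin ⟨f, hf⟩, by simp⟩

/-- A homogeneous submodule has homogeneous generators with no relation that has an invertible
coefficient. -/
lemma IsHomogSubmodule.exists_minimal_generators [Finite B] {deg : B → Fin n →₀ ℕ}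
    {K : Submodule (MvPolynomial (Fin n) k) (B →₀ MvPolynomial (Fin n) k)}
    (hK : IsHomogSubmodule deg K) :
    ∃ (r : ℕ) (g : Fin r → B →₀ MvPolynomial (Fin n) k) (q : Fin r → Fin n →₀ ℕ),
      (∀ j, IsHomog deg (q j) (g j)) ∧
      Submodule.span (MvPolynomial (Fin n) k) (Set.range g) = K ∧
      ∀ z, Finsupp.linearCombination (MvPolynomial (Fin n) k) g z = 0 →
        ∀ j, constantCoeff (z j) = 0 := by
  classical
  have hex := hK.exists_generators
  -- Minimality means the least possible number of homogeneous generators; a relation with an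
  -- invertible coefficient would make one of them redundant.
  obtain ⟨g, q, hg, hspan⟩ := Nat.find_spec hex
  have hmin := fun s hs => Nat.find_min hex (m := s) hs
  generalize Nat.find hex = r at *
  refine ⟨r, g, q, hg, hspan, fun z hz j => ?_⟩
  by_contra hc
  obtain _ | r := r
  · exact j.elim0
  refine hmin r (Nat.lt_succ_self r) ⟨g ∘ j.succAbove, q ∘ j.succAbove, fun i => hg _, ?_⟩
  refine le_antisymm (hspan ▸ Submodule.span_mono (Set.range_comp_subset_range _ _)) ?_
  rw [← hspan, Submodule.span_le]
  have hd : ∀ b, IsHomog deg (q b)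
      (Finsupp.linearCombination (MvPolynomial (Fin n) k) g (Finsupp.single b 1)) := by
    intro b
    simpa using hg b
  have hz' : Finsupp.linearCombination (MvPolynomial (Fin n) k) g (component q (q j) z) = 0 := by
    rw [← component_map _ hd, hz, map_zero]
  -- In multidegree `q j` the `j`-th coefficient of a relation is a scalar, so it can be inverted.
  have hzj : component q (q j) z j = C (constantCoeff (z j)) := by
    ext e
    rw [coeff_component, coeff_C]
    by_cases he : e = 0
    · subst he; simp [constantCoeff_eq]
    · rw [if_neg (by simpa using he), if_neg (Ne.symm he)]
  have hmem : g j ∈ Submodule.span (MvPolynomial (Fin n) k) (Set.range (g ∘ j.succAbove)) := by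
    rw [Finsupp.linearCombination_apply, Finsupp.sum_fintype _ _ (by simp),
      Fin.sum_univ_succAbove _ j, hzj] at hz'
    have h1 : (C (constantCoeff (z j)) : MvPolynomial (Fin n) k) • g j ∈
        Submodule.span (MvPolynomial (Fin n) k) (Set.range (g ∘ j.succAbove)) := by
      rw [eq_neg_of_add_eq_zero_left hz']
      exact Submodule.neg_mem _ (Submodule.sum_mem _ fun i _ =>
        Submodule.smul_mem _ _ (Submodule.subset_span ⟨i, rfl⟩))
    have h2 := Submodule.smul_mem _ (C (constantCoeff (z j))⁻¹ : MvPolynomial (Fin n) k) h1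
    rwa [smul_smul, ← C_mul, inv_mul_cancel₀ hc, C_1, one_smul] at h2
  rintro _ ⟨i, rfl⟩
  by_cases hi : i = j
  · exact hi ▸ hmem
  · obtain ⟨i', rfl⟩ := Fin.exists_succAbove_eq hi
    exact Submodule.subset_span ⟨i', rfl⟩

end MultigradedFree

/-! ### Existence of minimal resolutions -/

namespace MultigradedFree

open MvPolynomial

variable {k : Type*} [Field k] {n : ℕ}

lemma mem_monomialIdeal {q : ℕ} {a : Fin q → Fin n →₀ ℕ} {f : MvPolynomial (Fin n) k} :
    f ∈ monomialIdeal k a ↔ ∀ e ∈ f.support, ∃ j, a j ≤ e := by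
  have : (Set.range fun j => MvPolynomial.monomial (a j) (1 : k)) =
      (fun s => MvPolynomial.monomial s (1 : k)) '' Set.range a := by
    rw [← Set.range_comp]; rfl
  rw [monomialIdeal, this, mem_ideal_span_monomial_image]
  simp

lemma monomial_mem_monomialIdeal {q : ℕ} {a : Fin q → Fin n →₀ ℕ} {e : Fin n →₀ ℕ} {c : k}
    (hc : c ≠ 0) : monomial e c ∈ monomialIdeal k a ↔ ∃ j, a j ≤ e := by
  classical
  rw [mem_monomialIdeal, support_monomial, if_neg hc]
  simp

lemma constantCoeff_eq_zero_of_mem {q : ℕ} {a : Fin q → Fin n →₀ ℕ}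
    (ha : monomialIdeal k a ≠ ⊤) {f : MvPolynomial (Fin n) k} (hf : f ∈ monomialIdeal k a) :
    constantCoeff f = 0 := by
  by_contra h
  obtain ⟨j, hj⟩ := mem_monomialIdeal.1 hf 0 (mem_support_iff.2 h)
  exact ha ((Ideal.eq_top_iff_one _).2 ((monomial_mem_monomialIdeal one_ne_zero).2 ⟨j, hj⟩))

variable (k n) in
/-- A free module with a homogeneous submodule that contains no element with an invertible
coefficient: the kernel of the last map in a partial minimal resolution. -/
structure MinimalSyzygy where
  rank : ℕ
  deg : Fin rank → Fin n →₀ ℕ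
  syz : Submodule (MvPolynomial (Fin n) k) (Fin rank →₀ MvPolynomial (Fin n) k)
  homog : IsHomogSubmodule deg syz
  constantCoeff_eq_zero : ∀ z ∈ syz, ∀ j, constantCoeff (z j) = 0

lemma MinimalSyzygy.exists_next (s : MinimalSyzygy k n) :
    ∃ (s' : MinimalSyzygy k n) (d : (Fin s'.rank →₀ MvPolynomial (Fin n) k)
        →ₗ[MvPolynomial (Fin n) k] (Fin s.rank →₀ MvPolynomial (Fin n) k)),
      (∀ b, IsHomog s.deg (s'.deg b) (d (Finsupp.single b 1))) ∧ LinearMap.range d = s.syz ∧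
        s'.syz = LinearMap.ker d := by
  obtain ⟨r, g, q, hg, hspan, hmin⟩ := s.homog.exists_minimal_generators
  have hd : ∀ b, IsHomog s.deg (q b)
      (Finsupp.linearCombination (MvPolynomial (Fin n) k) g (Finsupp.single b 1)) := by
    intro b
    simpa using hg b
  exact ⟨⟨r, q, LinearMap.ker (Finsupp.linearCombination _ g), isHomogSubmodule_ker hd, hmin⟩,
    Finsupp.linearCombination _ g, hd, by rw [Finsupp.range_linearCombination, hspan], rfl⟩

lemma exists_initial_minimalSyzygy {q : ℕ} (a : Fin q → Fin n →₀ ℕ) :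
    ∃ (s : MinimalSyzygy k n) (aug : (Fin s.rank →₀ MvPolynomial (Fin n) k)
        →ₗ[MvPolynomial (Fin n) k] (MvPolynomial (Fin n) k ⧸ monomialIdeal k a)),
      (∀ b, ∃ c : k, aug (Finsupp.single b 1) =
        Ideal.Quotient.mk (monomialIdeal k a) (monomial (s.deg b) c)) ∧
      Function.Surjective aug ∧ s.syz = LinearMap.ker aug := by
  classical
  by_cases ha : monomialIdeal k a = ⊤
  -- For the unit ideal the rank must be `0`: with one generator the kernel would contain `1`,
  -- violating minimality.
  · have : Subsingleton (MvPolynomial (Fin n) k ⧸ monomialIdeal k a) :=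
      Ideal.Quotient.subsingleton_iff.2 ha
    exact ⟨⟨0, fun j => j.elim0, LinearMap.ker 0, fun f _ p => by simp,
      fun z _ j => j.elim0⟩, 0, fun b => b.elim0,
      fun y => ⟨0, Subsingleton.elim _ _⟩, rfl⟩
  · let aug : (Fin 1 →₀ MvPolynomial (Fin n) k) →ₗ[MvPolynomial (Fin n) k]
        (MvPolynomial (Fin n) k ⧸ monomialIdeal k a) :=
      (Submodule.mkQ (monomialIdeal k a)).comp (Finsupp.lapply 0)
    have haug : ∀ f, f ∈ LinearMap.ker aug ↔ f 0 ∈ monomialIdeal k a := by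
      intro f
      simp [aug, Ideal.Quotient.eq_zero_iff_mem]
    refine ⟨⟨1, fun _ => 0, LinearMap.ker aug, fun f hf p => ?_, fun z hz j => ?_⟩, aug,
      fun b => ⟨1, ?_⟩, fun y => ?_, rfl⟩
    · rw [haug, mem_monomialIdeal] at hf ⊢
      intro e he
      rw [mem_support_iff, coeff_component] at he
      refine hf e (mem_support_iff.2 fun h => he ?_)
      simp [h]
    · rw [haug] at hz
      rw [Subsingleton.elim j 0]
      exact constantCoeff_eq_zero_of_mem ha hz
    · rw [Subsingleton.elim b 0]
      simp [aug]
    · obtain ⟨f, rfl⟩ := Submodule.Quotient.mk_surjective _ y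
      exact ⟨Finsupp.single 0 f, by simp [aug]⟩

theorem exists_minimal_resolution {q : ℕ} (a : Fin q → Fin n →₀ ℕ) :
    ∃ F : MultigradedFreeResolution (monomialIdeal k a), F.IsMinimal := by
  obtain ⟨s₀, aug, haug, hsurj, hker⟩ := exists_initial_minimalSyzygy (k := k) a
  choose next d hd hrange hnext using MinimalSyzygy.exists_next (k := k) (n := n)
  let s : ℕ → MinimalSyzygy k n := fun i => next^[i] s₀
  have hs : ∀ i, s (i + 1) = next (s i) := fun i => Function.iterate_succ_apply' next i s₀
  have hD : ∀ i, ∃ d : (Fin (s (i + 1)).rank →₀ MvPolynomial (Fin n) k)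
        →ₗ[MvPolynomial (Fin n) k] (Fin (s i).rank →₀ MvPolynomial (Fin n) k),
      (∀ b, IsHomog (s i).deg ((s (i + 1)).deg b) (d (Finsupp.single b 1))) ∧
        LinearMap.range d = (s i).syz ∧ (s (i + 1)).syz = LinearMap.ker d := by
    intro i
    rw [hs i]
    exact ⟨d (s i), hd _, hrange _, hnext _⟩
  choose D hDh hDr hDk using hD
  refine ⟨⟨fun i => Fin (s i).rank, fun i => inferInstance, fun i => (s i).deg, D, aug,
    fun i b b' => hDh i b b', haug, fun i => ?_, ?_, hsurj⟩, fun i b b' hu => ?_⟩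
  · rw [LinearMap.exact_iff, hDr, hDk]
  · intro y
    have h : y ∈ LinearMap.range (D 0) ↔ y ∈ s₀.syz := by rw [hDr]; rfl
    exact (h.trans (by rw [hker]; exact Iff.rfl)).symm
  · have hmem : D i (Finsupp.single b 1) ∈ (s i).syz := hDr i ▸ LinearMap.mem_range_self _ _
    exact (hu.map constantCoeff).ne_zero ((s i).constantCoeff_eq_zero _ hmem b')

end MultigradedFree

/-! ### Setting the variables to one -/

namespace MultigradedFree

open MvPolynomial Finsupp

variable {k : Type*} [Field k] {n : ℕ} {B B' : Type*}

/-- The homogeneous element of multidegree `p` with given coefficients at the basis elements of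
degree at most `l`. -/
noncomputable def homogenize (deg : B → Fin n →₀ ℕ) (l p : Fin n →₀ ℕ) :
    ({b // deg b ≤ l} →₀ k) →ₗ[k] (B →₀ MvPolynomial (Fin n) k) :=
  linearCombination k fun b => single b.1 (monomial (p - deg b.1) 1)

lemma homogenize_single (deg : B → Fin n →₀ ℕ) (l p : Fin n →₀ ℕ) (b : {b // deg b ≤ l}) (c : k) :
    homogenize deg l p (single b c) = single b.1 (monomial (p - deg b.1) c) := by
  simp [homogenize, smul_monomial]

lemma homogenize_apply (deg : B → Fin n →₀ ℕ) (l p : Fin n →₀ ℕ) (x : {b // deg b ≤ l} →₀ k)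
    (b : {b // deg b ≤ l}) : homogenize deg l p x b = monomial (p - deg b.1) (x b) := by
  classical
  induction x using Finsupp.induction_linear with
  | zero => simp
  | add x y hx hy => simp [hx, hy]
  | single b' c =>
    rw [homogenize_single, single_apply, single_apply]
    by_cases h : b' = b
    · subst h; simp
    · simp [h, Subtype.coe_injective.ne h]

lemma homogenize_apply_of_not_le (deg : B → Fin n →₀ ℕ) (l p : Fin n →₀ ℕ)
    (x : {b // deg b ≤ l} →₀ k) {b : B} (hb : ¬ deg b ≤ l) : homogenize deg l p x b = 0 := by
  classical
  induction x using Finsupp.induction_linear with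
  | zero => simp
  | add x y hx hy => simp [hx, hy]
  | single b' c =>
    rw [homogenize_single, single_apply, if_neg]
    rintro rfl
    exact hb b'.2

lemma homogenize_injective (deg : B → Fin n →₀ ℕ) (l p : Fin n →₀ ℕ) :
    Function.Injective (homogenize (k := k) deg l p) := by
  intro x y h
  ext b
  have := DFunLike.congr_fun h b.1
  rw [homogenize_apply, homogenize_apply] at this
  simpa using congrArg (coeff (p - deg b.1)) this

/-- The coefficient vectors supported in degrees at most `p`. -/
noncomputable abbrev levelLE (k : Type*) [Field k] (deg : B → Fin n →₀ ℕ) (l p : Fin n →₀ ℕ) :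
    Submodule k ({b // deg b ≤ l} →₀ k) :=
  supported k k {b | deg b.1 ≤ p}

lemma isHomog_homogenize {deg : B → Fin n →₀ ℕ} {l p : Fin n →₀ ℕ} {x : {b // deg b ≤ l} →₀ k}
    (hx : x ∈ levelLE k deg l p) : IsHomog deg p (homogenize deg l p x) := by
  classical
  intro b e he
  by_cases hb : deg b ≤ l
  · rw [homogenize_apply deg l p x ⟨b, hb⟩, MvPolynomial.mem_support_iff, coeff_monomial] at he
    split_ifs at he with h
    · subst h
      refine tsub_add_cancel_of_le ?_
      by_contra hbp
      exact he ((mem_supported' k x).1 hx ⟨b, hb⟩ hbp)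
    · exact absurd rfl he
  · simp [homogenize_apply_of_not_le deg l p x hb] at he

/-- A homogeneous element of degree `p` has only one possible monomial at each basis element, so it
amounts to a coefficient vector: strands are levels of the filtration. -/
lemma IsHomog.exists_homogenize [Finite B] {deg : B → Fin n →₀ ℕ} {l p : Fin n →₀ ℕ} (hp : p ≤ l)
    {f : B →₀ MvPolynomial (Fin n) k} (hf : IsHomog deg p f) :
    ∃ x ∈ levelLE k deg l p, homogenize deg l p x = f := by
  classical
  have hzero : ∀ b, ¬ deg b ≤ p → f b = 0 := by
    intro b hb
    ext e
    by_contra h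
    exact hb (hf b e (MvPolynomial.mem_support_iff.2 h) ▸ le_add_self)
  refine ⟨equivFunOnFinite.symm fun b => coeff (p - deg b.1) (f b.1), ?_, ?_⟩
  · rw [mem_supported']
    intro b hb
    simp [hzero b.1 hb]
  · ext b e
    by_cases hb : deg b ≤ l
    · rw [homogenize_apply deg l p _ ⟨b, hb⟩, coeff_monomial]
      simp only [equivFunOnFinite_symm_apply_apply]
      split_ifs with h
      · rw [h]
      · by_contra h'
        refine h ?_
        rw [← hf b e (MvPolynomial.mem_support_iff.2 (Ne.symm h')), add_tsub_cancel_right]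
    · rw [homogenize_apply_of_not_le _ _ _ _ hb, hzero b fun h => hb (h.trans hp)]

lemma monomial_smul_homogenize {deg : B → Fin n →₀ ℕ} {l p q : Fin n →₀ ℕ} (hqp : q ≤ p)
    {x : {b // deg b ≤ l} →₀ k} (hx : x ∈ levelLE k deg l q) (c : k) :
    (monomial (p - q) c : MvPolynomial (Fin n) k) • homogenize deg l q x =
      homogenize deg l p (c • x) := by
  ext b : 1
  by_cases hb : deg b ≤ l
  · rw [Finsupp.smul_apply, homogenize_apply deg l p _ ⟨b, hb⟩, homogenize_apply deg l q _ ⟨b, hb⟩,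
      smul_eq_mul, monomial_mul, Finsupp.smul_apply, smul_eq_mul]
    by_cases hbq : deg b ≤ q
    · rw [tsub_add_tsub_cancel hqp hbq]
    · simp [(mem_supported' k x).1 hx ⟨b, hb⟩ hbq]
  · simp [homogenize_apply_of_not_le _ _ _ _ hb]

/-- The matrix of a homogeneous map, with all variables replaced by `1`. -/
lemma exists_dehomogenize [Finite B] {deg : B → Fin n →₀ ℕ} {deg' : B' → Fin n →₀ ℕ}
    (d : (B' →₀ MvPolynomial (Fin n) k) →ₗ[MvPolynomial (Fin n) k] (B →₀ MvPolynomial (Fin n) k))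
    (hd : ∀ b, IsHomog deg (deg' b) (d (single b 1))) (l : Fin n →₀ ℕ) :
    ∃ D : ({b // deg' b ≤ l} →₀ k) →ₗ[k] ({b // deg b ≤ l} →₀ k),
      (∀ b, D (single b 1) ∈ levelLE k deg l (deg' b.1)) ∧
      ∀ p, ∀ x ∈ levelLE k deg' l p, d (homogenize deg' l p x) = homogenize deg l p (D x) := by
  choose w hw hwd using fun b : {b // deg' b ≤ l} => (hd b.1).exists_homogenize b.2
  refine ⟨linearCombination k w, fun b => by simpa using hw b, fun p x hx => ?_⟩
  have : levelLE k deg' l p ≤ LinearMap.ker ((d.restrictScalars k).comp (homogenize deg' l p) -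
      (homogenize deg l p).comp (linearCombination k w)) := by
    rw [levelLE, supported_eq_span_single, Submodule.span_le]
    rintro _ ⟨b, hb, rfl⟩
    have h : single b.1 (monomial (p - deg' b.1) (1 : k)) =
        monomial (p - deg' b.1) (1 : k) • single b.1 (1 : MvPolynomial (Fin n) k) := by simp
    simp only [SetLike.mem_coe, LinearMap.mem_ker, LinearMap.sub_apply, LinearMap.comp_apply,
      LinearMap.coe_restrictScalars, homogenize_single, linearCombination_single, one_smul]
    rw [h, map_smul, ← hwd, monomial_smul_homogenize hb (hw b), one_smul, sub_self]
  simpa [sub_eq_zero] using this hx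

end MultigradedFree

/-! ### The cube below the lcm and the Betti numbers -/

namespace MultigradedFree

open MvPolynomial Finsupp

variable {k : Type*} [Field k] {n q : ℕ}

/-- The exponent vectors `l - ε`, where `ε` has entries in `{0, 1}`. -/
abbrev Cube (l : Fin n →₀ ℕ) : Type := {p : Fin n →₀ ℕ // p ≤ l ∧ ∀ v, l v ≤ p v + 1}

namespace Cube

/-- The greatest element of the cube. -/
def top (l : Fin n →₀ ℕ) : Cube l := ⟨l, le_rfl, fun _ => Nat.le_succ _⟩

lemma isMax_top (l : Fin n →₀ ℕ) : IsMax (top l) := fun p _ => p.2.1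

/-- The least element of the cube above a given exponent vector. -/
noncomputable def corner (l e : Fin n →₀ ℕ) : Cube l :=
  ⟨equivFunOnFinite.symm fun v => if e v = l v then l v else l v - 1,
    fun v => by simp only [equivFunOnFinite_symm_apply_apply]; split_ifs <;> omega,
    fun v => by simp only [equivFunOnFinite_symm_apply_apply]; split_ifs <;> omega⟩

lemma corner_le_iff {l e : Fin n →₀ ℕ} (he : e ≤ l) {p : Cube l} : corner l e ≤ p ↔ e ≤ p.1 := by
  rw [← Subtype.coe_le_coe, Finsupp.le_def, Finsupp.le_def]
  refine forall_congr' fun v => ?_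
  have h1 := p.2.1 v
  have h2 := p.2.2 v
  have h3 := he v
  simp only [corner, equivFunOnFinite_symm_apply_apply]
  split_ifs <;> omega

lemma corner_eq_top_iff {l e : Fin n →₀ ℕ} (he : e ≤ l) : corner l e = top l ↔ e = l := by
  rw [Subtype.ext_iff, Finsupp.ext_iff, Finsupp.ext_iff]
  refine forall_congr' fun v => ?_
  have h3 := he v
  simp only [corner, top, equivFunOnFinite_symm_apply_apply]
  split_ifs <;> omega

/-- The exponent vectors in the cube of monomials outside the ideal generated by monomials with
exponent vectors `a j`. -/
def standard (l : Fin n →₀ ℕ) (a : Fin q → Fin n →₀ ℕ) : Set (Cube l) :=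
  {p | ¬ ∃ j, a j ≤ p.1}

lemma isLowerSet_standard (l : Fin n →₀ ℕ) (a : Fin q → Fin n →₀ ℕ) :
    IsLowerSet (standard l a) :=
  fun _ _ hpq hp ⟨j, hj⟩ => hp ⟨j, hj.trans hpq⟩

lemma standard_twinExponent (a : Fin q → Fin n →₀ ℕ) :
    standard (lcmExponent a) (twinExponent a) = standard (lcmExponent a) a := by
  ext p
  refine not_congr (exists_congr fun j => ?_)
  rw [Finsupp.le_def, Finsupp.le_def]
  -- In each variable `p v` is the maximum or one less: the maximum bounds both exponents, and one
  -- less bounds either exactly when `a j v` is not maximal.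
  refine forall_congr' fun v => ?_
  have h1 := p.2.1 v
  have h2 := p.2.2 v
  have h3 : a j v ≤ lcmExponent a v := Finset.le_sup (f := a) (Finset.mem_univ j) v
  simp only [twinExponent, equivFunOnFinite_symm_apply_apply]
  split_ifs <;> omega

end Cube

lemma coeff_eq_zero_of_mem_monomialIdeal {a : Fin q → Fin n →₀ ℕ} {f : MvPolynomial (Fin n) k}
    (hf : f ∈ monomialIdeal k a) {p : Fin n →₀ ℕ} (hp : ¬ ∃ j, a j ≤ p) : coeff p f = 0 := by
  by_contra h
  exact hp (mem_monomialIdeal.1 hf p (MvPolynomial.mem_support_iff.2 h))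

lemma aug_homogenize {B : Type*} {l : Fin n →₀ ℕ} {I : Ideal (MvPolynomial (Fin n) k)}
    {deg : B → Fin n →₀ ℕ}
    (aug : (B →₀ MvPolynomial (Fin n) k) →ₗ[MvPolynomial (Fin n) k] (MvPolynomial (Fin n) k ⧸ I))
    {c : B → k} (hc : ∀ b, aug (single b 1) = Ideal.Quotient.mk I (monomial (deg b) (c b)))
    {p : Fin n →₀ ℕ} {x : {b // deg b ≤ l} →₀ k} (hx : x ∈ levelLE k deg l p) :
    aug (homogenize deg l p x) =
      Ideal.Quotient.mk I (monomial p (linearCombination k (fun b => c b.1) x)) := by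
  have : levelLE k deg l p ≤ LinearMap.ker ((aug.restrictScalars k).comp (homogenize deg l p) -
      ((Ideal.Quotient.mkₐ k I).toLinearMap.comp (monomial p)).comp
        (linearCombination k (fun b => c b.1))) := by
    rw [levelLE, supported_eq_span_single, Submodule.span_le]
    rintro _ ⟨b, hb, rfl⟩
    have h : single b.1 (monomial (p - deg b.1) (1 : k)) =
        monomial (p - deg b.1) (1 : k) • single b.1 (1 : MvPolynomial (Fin n) k) := by simp
    have hb : deg b.1 ≤ p := hb
    simp only [SetLike.mem_coe, LinearMap.mem_ker, LinearMap.sub_apply, LinearMap.comp_apply,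
      LinearMap.coe_restrictScalars, homogenize_single, linearCombination_single, one_smul]
    rw [h, map_smul, hc, sub_eq_zero]
    change Ideal.Quotient.mk I (monomial (p - deg b.1) 1 * monomial (deg b.1) (c b.1)) = _
    rw [monomial_mul, tsub_add_cancel_of_le hb, one_mul]
    rfl
  have := this hx
  rw [LinearMap.mem_ker, LinearMap.sub_apply, sub_eq_zero] at this
  exact this

/-- Homogeneity of the augmentation, phrased through a representative `g` so that no grading on the
quotient ring is needed. -/
lemma exists_aug_component {B : Type*} {I : Ideal (MvPolynomial (Fin n) k)}
    {deg : B → Fin n →₀ ℕ}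
    (aug : (B →₀ MvPolynomial (Fin n) k) →ₗ[MvPolynomial (Fin n) k] (MvPolynomial (Fin n) k ⧸ I))
    {c : B → k} (hc : ∀ b, aug (single b 1) = Ideal.Quotient.mk I (monomial (deg b) (c b)))
    (p : Fin n →₀ ℕ) (f : B →₀ MvPolynomial (Fin n) k) :
    ∃ g, aug f = Ideal.Quotient.mk I g ∧
      aug (component deg p f) = Ideal.Quotient.mk I (monomial p (coeff p g)) := by
  classical
  induction f using Finsupp.induction_linear with
  | zero => exact ⟨0, by simp, by simp⟩
  | add f f' hf hf' =>
    obtain ⟨g, h1, h2⟩ := hf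
    obtain ⟨g', h1', h2'⟩ := hf'
    exact ⟨g + g', by simp only [map_add, h1, h1'], by simp only [map_add, h2, h2', coeff_add]⟩
  | single b a =>
    induction a using MvPolynomial.induction_on' with
    | add f f' hf hf' =>
      obtain ⟨g, h1, h2⟩ := hf
      obtain ⟨g', h1', h2'⟩ := hf'
      exact ⟨g + g', by simp only [single_add, map_add, h1, h1'],
        by simp only [single_add, map_add, h2, h2', coeff_add]⟩
    | monomial e r =>
      have h : single b (monomial e r) =
          monomial e r • single b (1 : MvPolynomial (Fin n) k) := by simp
      have h1 := (isHomog_single_one (k := k) deg b).monomial_smul e r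
      have h2 : aug (monomial e r • single b (1 : MvPolynomial (Fin n) k)) =
          Ideal.Quotient.mk I (monomial (e + deg b) (r * c b)) := by
        rw [map_smul, hc, ← monomial_mul, map_mul]
        rfl
      rw [h]
      refine ⟨_, h2, ?_⟩
      by_cases hp : e + deg b = p
      · subst hp
        rw [h1.component_eq, h2, coeff_monomial, if_pos rfl]
      · rw [h1.component_eq_zero hp, coeff_monomial, if_neg hp]
        simp

/-- The basis elements of degree at most `l` of a multigraded resolution, with all variables
replaced by `1`, and with degrees rounded up to the cube below `l`. -/
theorem exists_filteredResolution {a : Fin q → Fin n →₀ ℕ}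
    (F : MultigradedFreeResolution (monomialIdeal k a)) (hF : F.IsMinimal) (l : Fin n →₀ ℕ) :
    ∃ X : FilteredResolution k (Cube.standard l a), X.IsMinimalAt (Cube.top l) ∧
      ∀ i, Nat.card {b : X.cell i // X.deg i b = Cube.top l} = F.numBasis i l := by
  classical
  have := F.finite_basis
  have hd : ∀ i b, IsHomog (F.mdeg i) (F.mdeg (i + 1) b) (F.d i (single b 1)) :=
    fun i b b' => F.d_homogeneous i b b'
  choose D hD hDd using fun i => exists_dehomogenize (F.d i) (hd i) l
  choose c hc using F.aug_homogeneous
  have haug := fun p x hx => aug_homogenize (l := l) F.aug hc (p := p) (x := x) hx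
  have hlev : ∀ i (p : Cube l), supported k k {b : {b // F.mdeg i b ≤ l} |
      Cube.corner l (F.mdeg i b.1) ≤ p} = levelLE k (F.mdeg i) l p.1 := by
    intro i p
    congr 1
    ext b
    exact Cube.corner_le_iff b.2
  have htop : ∀ i (x : {b // F.mdeg i b ≤ l} →₀ k), x ∈ levelLE k (F.mdeg i) l l :=
    fun i x => (mem_supported' k x).2 fun b hb => absurd b.2 hb
  have hDmem : ∀ i p x, x ∈ levelLE k (F.mdeg (i + 1)) l p → D i x ∈ levelLE k (F.mdeg i) l p := by
    intro i p x hx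
    have : levelLE k (F.mdeg (i + 1)) l p ≤ (levelLE k (F.mdeg i) l p).comap (D i) := by
      rw [levelLE, supported_eq_span_single, Submodule.span_le]
      rintro _ ⟨b, hb, rfl⟩
      have hle : levelLE k (F.mdeg i) l (F.mdeg (i + 1) b.1) ≤ levelLE k (F.mdeg i) l p :=
        Finsupp.supported_mono fun b' (hb' : F.mdeg i b'.1 ≤ _) => hb'.trans hb
      exact hle (hD i b)
    exact this hx
  -- Exactness passes to each strand: replace a preimage by its component of degree `p`.
  have hlift : ∀ i (p : Fin n →₀ ℕ), p ≤ l → ∀ z ∈ levelLE k (F.mdeg i) l p,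
      homogenize (F.mdeg i) l p z ∈ LinearMap.range (F.d i) →
      ∃ y ∈ levelLE k (F.mdeg (i + 1)) l p, D i y = z := by
    rintro i p hp z hz ⟨f, hf⟩
    obtain ⟨y, hy, hyf⟩ := (isHomog_component (F.mdeg (i + 1)) p f).exists_homogenize hp
    refine ⟨y, hy, homogenize_injective _ l p ?_⟩
    rw [← hDd i p y hy, hyf, ← component_map _ (hd i), hf, (isHomog_homogenize hz).component_eq]
  let X : FilteredResolution k (Cube.standard l a) :=
    { cell := fun i => {b // F.mdeg i b ≤ l}
      finite_cell := fun i => inferInstance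
      deg := fun i b => Cube.corner l (F.mdeg i b.1)
      d := D
      aug := linearCombination k fun b => c b.1
      d_mem := fun i b => by
        rw [hlev]
        exact hDmem i _ _ (single_mem_supported k 1 ((Cube.corner_le_iff b.2).1 le_rfl))
      d_d := fun i x => by
        refine homogenize_injective _ l l ?_
        rw [← hDd i l _ (htop _ _), ← hDd (i + 1) l _ (htop _ _),
          (F.exact_d i).apply_apply_eq_zero, map_zero]
      exact_d := fun i p z hz h => by
        rw [hlev] at hz ⊢
        refine hlift (i + 1) p.1 p.2.1 z hz ?_
        exact (F.exact_d i _).1 (by rw [hDd i _ _ hz, h, map_zero])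
      aug_d := fun p hp y hy => by
        rw [hlev] at hy
        by_contra h
        have h1 := haug p.1 _ (hDmem 0 _ _ hy)
        rw [← hDd 0 _ _ hy, F.exact_aug.apply_apply_eq_zero, eq_comm,
          Ideal.Quotient.eq_zero_iff_mem, monomial_mem_monomialIdeal h] at h1
        exact hp h1
      exact_aug := fun p z hz h => by
        rw [hlev] at hz ⊢
        refine hlift 0 p.1 p.2.1 z hz ((F.exact_aug _).1 ?_)
        rw [haug p.1 z hz]
        by_cases hp : p ∈ Cube.standard l a
        · rw [h hp, map_zero, map_zero]
        · rw [Ideal.Quotient.eq_zero_iff_mem]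
          by_cases h0 : linearCombination k (fun b : {b // F.mdeg 0 b ≤ l} => c b.1) z = 0
          · rw [h0, map_zero]
            exact Submodule.zero_mem _
          · exact (monomial_mem_monomialIdeal h0).2 (not_not.1 hp)
      aug_surjective := fun p hp => by
        rw [hlev]
        obtain ⟨f, hf⟩ := F.aug_surjective (Ideal.Quotient.mk _ (monomial p.1 1))
        obtain ⟨x, hx, hxf⟩ := (isHomog_component (F.mdeg 0) p.1 f).exists_homogenize p.2.1
        refine ⟨x, hx, ?_⟩
        -- Modulo the ideal, `g` agrees with the monomial `p`; as that monomial is standard,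
        -- comparing coefficients at `p` gives augmentation `1`.
        obtain ⟨g, hg, hgp⟩ := exists_aug_component F.aug hc p.1 f
        rw [← hxf, haug p.1 x hx, Ideal.Quotient.eq, ← map_sub] at hgp
        rw [hg, Ideal.Quotient.eq] at hf
        have h1 := coeff_eq_zero_of_mem_monomialIdeal hf hp
        have h2 := coeff_eq_zero_of_mem_monomialIdeal hgp hp
        rw [coeff_sub, coeff_monomial, if_pos rfl, sub_eq_zero] at h1
        rwa [coeff_monomial, if_pos rfl, sub_eq_zero, h1] at h2 }
  refine ⟨X, ?_, fun i => ?_⟩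
  · intro i x b hb
    have hb : F.mdeg i b.1 = l := (Cube.corner_eq_top_iff b.2).1 hb
    have : (⊤ : Submodule k _) ≤ LinearMap.ker ((lapply b).comp (D i)) := by
      rw [← Finsupp.supported_univ, supported_eq_span_single, Submodule.span_le]
      rintro _ ⟨b', -, rfl⟩
      by_contra h
      have h : D i (single b' 1) b ≠ 0 := h
      -- A nonzero entry at a basis element of degree `l` forces the source degree to be `l` too;
      -- such an entry is a nonzero scalar, against minimality.
      have hle : l ≤ F.mdeg (i + 1) b'.1 := by
        by_contra hle
        exact h ((mem_supported' k _).1 (hD i b') b (by simpa [hb] using hle))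
      have heq : F.mdeg (i + 1) b'.1 = l := le_antisymm b'.2 hle
      refine hF i b'.1 b.1 ?_
      have h1 := DFunLike.congr_fun (hDd i l (single b' 1) (htop _ _)) b.1
      rw [homogenize_single, heq, homogenize_apply, hb, tsub_self] at h1
      rw [show (single b'.1 1 : _ →₀ MvPolynomial (Fin n) k) = single b'.1 (monomial 0 1) from rfl,
        h1]
      exact (isUnit_iff_ne_zero.2 h).map C
    exact this (Submodule.mem_top (x := x))
  · exact Nat.card_congr
      { toFun := fun b => ⟨b.1.1, (Cube.corner_eq_top_iff b.1.2).1 b.2⟩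
        invFun := fun b => ⟨⟨b.1, b.2.le⟩, (Cube.corner_eq_top_iff b.2.le).2 b.2⟩
        left_inv := fun b => rfl
        right_inv := fun b => rfl }

theorem numBasis_eq_of_standard_eq {q' : ℕ} {a : Fin q → Fin n →₀ ℕ} {a' : Fin q' → Fin n →₀ ℕ}
    {l : Fin n →₀ ℕ} (h : Cube.standard l a = Cube.standard l a')
    (F : MultigradedFreeResolution (monomialIdeal k a)) (hF : F.IsMinimal)
    (F' : MultigradedFreeResolution (monomialIdeal k a')) (hF' : F'.IsMinimal) (i : ℕ) :
    F.numBasis i l = F'.numBasis i l := by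
  obtain ⟨X, hX, hXc⟩ := exists_filteredResolution F hF l
  obtain ⟨Y, hY, hYc⟩ := exists_filteredResolution F' hF' l
  rw [← hXc, ← hYc]
  clear hXc hYc
  -- The type of `X` depends on the set being rewritten.
  revert X
  rw [h]
  intro X hX
  exact FilteredResolution.card_eq_of_isMinimalAt (Cube.isLowerSet_standard l a')
    (Cube.isMax_top l) X Y hX hY i

end MultigradedFree

open MultigradedFree in
theorem mainTheorem7 {k : Type*} [Field k] {n q : ℕ} (a : Fin q → Fin n →₀ ℕ) (i : ℕ) :
    ∃ β : ℕ, IsMultigradedBetti (monomialIdeal k a) i (lcmExponent a) β ∧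
      IsMultigradedBetti (monomialIdeal k (twinExponent a)) i (lcmExponent a) β := by
  obtain ⟨F, hF⟩ := exists_minimal_resolution (k := k) a
  refine ⟨F.numBasis i (lcmExponent a), ⟨⟨F, hF⟩, fun G hG => ?_⟩,
    exists_minimal_resolution _, fun G hG => ?_⟩
  · exact numBasis_eq_of_standard_eq rfl G hG F hF i
  · exact numBasis_eq_of_standard_eq (Cube.standard_twinExponent a) G hG F hF i
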